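/- Let $R$ be a finite dimensional algebra over an algebraically closed field $k$, and let $\mathrm{mod}\,R$ be the category of finitely generated left $R$-modules. For $M\in\mathrm{mod}\,R$ let $\mathrm{pd}\,M\in\mathbb N\cup\{\infty\}$ be its projective dimension (with $\mathrm{pd}\,0=0$), and let $\Omega M$ be its syzygy, i.e. the kernel of a projective cover of $M$. For a class $\mathcal C$ of modules, $\mathrm{pfd}\,\mathcal C:=\sup\{\mathrm{pd}\,M : M\in\mathcal C,\ \mathrm{pd}\,M<\infty\}$. A stratifying system $(\theta,\le)$ of size $t\ge 1$ is a family $\theta(1),\dots,\theta(t)$ of indecomposable modules in $\mathrm{mod}\,R$ with $\mathrm{Hom}_R(\theta(j),\theta(i))=0$ for $j>i$ and $\mathrm{Ext}^1_R(\theta(j),\theta(i))=0$ for $j\ge i$. Let $\mathcal F(\theta)$ be the class of all $M\in\mathrm{mod}\,R$ that have a finite chain $0=M_0\subseteq M_1\subseteq\cdots\subseteq M_m=M$ of submodules ($m\ge 0$) such that each $M_l/M_{l-1}$ is isomorphic to some $\theta(i)$. Let $\mathcal K$ be the abelian group generated by the symbols $[M]$, $M\in\mathrm{mod}\,R$, modulo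 the relations $[C]=[A]+[B]$ if $C\simeq A\oplus B$, and $[P]=0$ if $P$ is projective; the syzygy induces an endomorphism $\Omega$ of $\mathcal K$, $\Omega[M]=[\Omega M]$. Let $\langle M\rangle\subseteq\mathcal K$ be the subgroup generated by the classes of the indecomposable direct summands of $M$, let $\Phi(M)$ be the smallest $n\ge 0$ such that $\Omega:\Omega^m\langle M\rangle\to\Omega^{m+1}\langle M\rangle$ is an isomorphism for all $m\ge n$, let $\mathcal C_M$ be the class of direct summands of $\Omega^{\Phi(M)}M$, and let $\Psi(M):=\Phi(M)+\mathrm{pfd}\,\mathcal C_M\in\mathbb N$ (the Igusa–Todorov function). For a class $\mathcal X$ of modules let $\Psi\mathrm d(\mathcal X):=\sup\{\Psi(X):X\in\mathcal X\}$. **Theorem.** Let $(\theta,\le)$ be a stratifying system of size $t$ in $\mathrm{mod}\,R$ such that $\{i:\mathrm{pd}\,\theta(i)=\infty\}=\{i_0\}$. Put $s:=\max\{\mathrm{pd}\,\theta(j): j\ne i_0\}$ if $t>1$, and $s:=0$ if $t=1$. Then (a) $\mathrm{pfd}\,\mathcal F(\theta)\le s$; (b) $\Psi\mathrm d(\mathcal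 F(\theta))\le 1+s+\Psi(\Omega^{s+1}\theta(i_0))$. -/

import Mathlib

open CategoryTheory

/-! Throughout, `FGModuleCat.{u} R` plays the role of `mod R`, the category of finitely generated
left `R`-modules. -/

namespace StratSys

universe u

section Basic

variable {R : Type u} [Ring R]

/-- The projective dimension of `M`, in `ℕ ∪ {∞}`, with the convention `pd 0 = 0`
(Mathlib's `projectiveDimension` is `⊥` on the zero module). -/
noncomputable def pd (M : FGModuleCat.{u} R) : ℕ∞ :=
  (projectiveDimension M.obj).unbotD 0

/-- The projective finitistic dimension of a class `C` of modules:
the supremum of the projective dimensions of those members for which it is finite. -/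
noncomputable def pfd (C : Set (FGModuleCat.{u} R)) : ℕ∞ :=
  sSup {d : ℕ∞ | d ≠ ⊤ ∧ ∃ M ∈ C, pd M = d}

/-- `M` is indecomposable: nonzero, and not an internal direct sum of two nonzero submodules. -/
def IsIndecomposable (M : FGModuleCat.{u} R) : Prop :=
  Nontrivial M ∧ ∀ A B : Submodule R M, IsCompl A B → A = ⊥ ∨ B = ⊥

/-- `X` is (isomorphic to) a direct summand of `M`. -/
def IsDirectSummand (X M : FGModuleCat.{u} R) : Prop :=
  ∃ Y : FGModuleCat.{u} R, Nonempty (M ≃ₗ[R] (X × Y))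

/-- `M` belongs to `F(C)`: there is a finite chain `0 = M₀ ⊆ M₁ ⊆ ⋯ ⊆ Mₘ = M` of submodules whose
successive quotients are isomorphic to members of `C`. The zero module is the case `m = 0`. -/
def filtered (C : Set (FGModuleCat.{u} R)) : Set (FGModuleCat.{u} R) :=
  {M | ∃ (m : ℕ) (F : ℕ → Submodule R M), F 0 = ⊥ ∧ F m = ⊤ ∧
    ∀ i < m, F i ≤ F (i + 1) ∧
      ∃ X ∈ C, Nonempty ((F (i + 1) ⧸ (F i).submoduleOf (F (i + 1))) ≃ₗ[R] X)}

/-- A stratifying system of size `t`, for the natural order on the index set `Fin t`. -/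
structure IsStratifyingSystem {t : ℕ} (θ : Fin t → FGModuleCat.{u} R) : Prop where
  indecomposable : ∀ i, IsIndecomposable (θ i)
  hom_eq_zero : ∀ i j, i < j → ∀ f : θ j →ₗ[R] θ i, f = 0
  ext_eq_zero : ∀ i j, i ≤ j → Subsingleton (Abelian.Ext.{u} (θ j).obj (θ i).obj 1)

/-- `f : P → M` is a projective cover: `P` is projective, `f` is surjective and its kernel is
superfluous. -/
structure IsProjectiveCover {P M : Type*} [AddCommGroup P] [AddCommGroup M] [Module R P]
    [Module R M] (f : P →ₗ[R] M) : Prop where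
  projective : Module.Projective R P
  surjective : Function.Surjective f
  superfluous : ∀ N : Submodule R P, N ⊔ LinearMap.ker f = ⊤ → N = ⊤

/-- The relations defining `𝒦`: `[C] = [A] + [B]` if `C ≃ A ⊕ B`, and `[P] = 0` if `P` is
projective. -/
def stableRelations (R : Type u) [Ring R] : Set (FreeAbelianGroup (FGModuleCat.{u} R)) :=
  {x | ∃ A B C : FGModuleCat.{u} R, Nonempty (C ≃ₗ[R] (A × B)) ∧
      x = FreeAbelianGroup.of C - (FreeAbelianGroup.of A + FreeAbelianGroup.of B)} ∪
  {x | ∃ P : FGModuleCat.{u} R, Module.Projective R P ∧ x = FreeAbelianGroup.of P}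

/-- The abelian group `𝒦` generated by the symbols `[M]`, `M ∈ mod R`, modulo the relations
`[C] = [A] + [B]` if `C ≃ A ⊕ B`, and `[P] = 0` if `P` is projective. -/
abbrev StableGroup (R : Type u) [Ring R] : Type (u + 1) :=
  FreeAbelianGroup (FGModuleCat.{u} R) ⧸ AddSubgroup.closure (stableRelations R)

/-- The class `[M]` of `M` in `𝒦`. -/
def cls (M : FGModuleCat.{u} R) : StableGroup R :=
  QuotientAddGroup.mk (FreeAbelianGroup.of M)

/-- The subgroup `⟨M⟩` of `𝒦` generated by the indecomposable direct summands of `M`. -/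
def summandGroup (M : FGModuleCat.{u} R) : AddSubgroup (StableGroup R) :=
  AddSubgroup.closure {x | ∃ X, IsIndecomposable X ∧ IsDirectSummand X M ∧ cls X = x}

theorem cls_add {A B C : FGModuleCat.{u} R} (e : C ≃ₗ[R] (A × B)) : cls C = cls A + cls B := by
  have : (QuotientAddGroup.mk (FreeAbelianGroup.of C) : StableGroup R) =
      QuotientAddGroup.mk (FreeAbelianGroup.of A + FreeAbelianGroup.of B) := by
    rw [QuotientAddGroup.eq_iff_sub_mem]
    exact AddSubgroup.subset_closure (Or.inl ⟨A, B, C, ⟨e⟩, rfl⟩)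
  exact this

theorem cls_projective {P : FGModuleCat.{u} R} (hP : Module.Projective R P) : cls P = 0 :=
  (QuotientAddGroup.eq_zero_iff _).2 (AddSubgroup.subset_closure (Or.inr ⟨P, hP, rfl⟩))

end Basic

section ProjectiveCover

variable {R : Type u} [Ring R]

/-- Projective covers are unique, and so are their kernels. -/
theorem IsProjectiveCover.nonempty_ker_equiv {P M P' M' : Type*} [AddCommGroup P] [AddCommGroup M]
    [Module R P] [Module R M] [AddCommGroup P'] [AddCommGroup M'] [Module R P'] [Module R M']
    [IsNoetherian R P] {f : P →ₗ[R] M} {f' : P' →ₗ[R] M'} (hf : IsProjectiveCover f)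
    (hf' : IsProjectiveCover f') (e : M ≃ₗ[R] M') :
    Nonempty (LinearMap.ker f ≃ₗ[R] LinearMap.ker f') := by
  have := hf.projective
  have := hf'.projective
  obtain ⟨g, hg⟩ := Module.projective_lifting_property f' (e.toLinearMap ∘ₗ f) hf'.surjective
  obtain ⟨g', hg'⟩ := Module.projective_lifting_property f (e.symm.toLinearMap ∘ₗ f') hf.surjective
  have hg1 : ∀ x, f' (g x) = e (f x) := fun x ↦ LinearMap.congr_fun hg x
  have hg2 : ∀ x, f (g' x) = e.symm (f' x) := fun x ↦ LinearMap.congr_fun hg' x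
  have s1 : Function.Surjective g := by
    rw [← LinearMap.range_eq_top]
    refine hf'.superfluous _ (eq_top_iff.2 fun x _ ↦ ?_)
    obtain ⟨y, hy⟩ := hf.surjective (e.symm (f' x))
    refine Submodule.mem_sup.2 ⟨g y, ⟨y, rfl⟩, x - g y, ?_, by abel⟩
    simp [hg1, hy]
  have s2 : Function.Surjective g' := by
    rw [← LinearMap.range_eq_top]
    refine hf.superfluous _ (eq_top_iff.2 fun x _ ↦ ?_)
    obtain ⟨y, hy⟩ := hf'.surjective (e (f x))
    refine Submodule.mem_sup.2 ⟨g' y, ⟨y, rfl⟩, x - g' y, ?_, by abel⟩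
    simp [hg2, hy]
  have b := IsNoetherian.bijective_of_surjective_endomorphism (g' ∘ₗ g) (s2.comp s1)
  have i1 : Function.Injective g := Function.Injective.of_comp (f := g') b.1
  let E := LinearEquiv.ofBijective g ⟨i1, s1⟩
  refine ⟨E.ofSubmodules _ _ ?_⟩
  ext y
  constructor
  · rintro ⟨x, hx, rfl⟩
    have hx' : f x = 0 := hx
    show f' (g x) = 0
    simp [hg1, hx']
  · intro hy
    obtain ⟨x, rfl⟩ := s1 y
    refine ⟨x, ?_, rfl⟩
    have h0 : f' (g x) = 0 := hy
    rw [hg1] at h0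
    show f x = 0
    simpa using h0

/-- The direct sum of two projective covers is a projective cover. -/
theorem IsProjectiveCover.prodMap {P M P' M' : Type*} [AddCommGroup P] [AddCommGroup M]
    [Module R P] [Module R M] [AddCommGroup P'] [AddCommGroup M'] [Module R P'] [Module R M']
    {f : P →ₗ[R] M} {f' : P' →ₗ[R] M'} (hf : IsProjectiveCover f)
    (hf' : IsProjectiveCover f') : IsProjectiveCover (f.prodMap f') := by
  have := hf.projective
  have := hf'.projective
  refine ⟨inferInstance, hf.surjective.prodMap hf'.surjective, fun N hN ↦ ?_⟩
  have key : ∀ p p', f p = 0 → f' p' = 0 → (p, p') ∈ N := by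
    have h2 : ∀ p', f' p' = 0 → ((0 : P), p') ∈ N ⊔ (LinearMap.ker f).map (LinearMap.inl R P P') := by
      have : Submodule.comap (LinearMap.inr R P P')
          (N ⊔ (LinearMap.ker f).map (LinearMap.inl R P P')) = ⊤ := by
        refine hf'.superfluous _ (eq_top_iff.2 fun x _ ↦ ?_)
        have hx : ((0 : P), x) ∈ N ⊔ LinearMap.ker (f.prodMap f') := by rw [hN]; trivial
        obtain ⟨⟨a, b⟩, hab, ⟨c, d⟩, hcd, h⟩ := Submodule.mem_sup.1 hx
        simp only [LinearMap.mem_ker, LinearMap.prodMap_apply, Prod.mk_eq_zero] at hcd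
        simp only [Prod.mk_add_mk, Prod.mk.injEq] at h
        refine Submodule.mem_sup.2 ⟨b, ?_, d, hcd.2, h.2⟩
        refine Submodule.mem_sup.2 ⟨(a, b), hab, (c, 0), ⟨c, hcd.1, rfl⟩, ?_⟩
        simp [h.1]
      intro p' _
      have hp : p' ∈ Submodule.comap (LinearMap.inr R P P')
          (N ⊔ (LinearMap.ker f).map (LinearMap.inl R P P')) := by rw [this]; trivial
      exact hp
    have h1 : Submodule.comap (LinearMap.inl R P P') N = ⊤ := by
      refine hf.superfluous _ (eq_top_iff.2 fun x _ ↦ ?_)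
      have hx : (x, (0 : P')) ∈ N ⊔ LinearMap.ker (f.prodMap f') := by rw [hN]; trivial
      obtain ⟨⟨a, b⟩, hab, ⟨c, d⟩, hcd, h⟩ := Submodule.mem_sup.1 hx
      simp only [LinearMap.mem_ker, LinearMap.prodMap_apply, Prod.mk_eq_zero] at hcd
      simp only [Prod.mk_add_mk, Prod.mk.injEq] at h
      obtain ⟨n, hn, w, ⟨q, hq, rfl⟩, hnq⟩ := Submodule.mem_sup.1 (h2 d hcd.2)
      have hq' : f q = 0 := hq
      refine Submodule.mem_sup.2 ⟨a - q, ?_, c + q, ?_, by rw [← h.1]; abel⟩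
      · have : (a - q, (0 : P')) = (a, b) + n := by
          have : n = (0, d) - LinearMap.inl R P P' q := by rw [← hnq]; abel
          rw [this]
          ext
          · simp [sub_eq_add_neg]
          · simp [h.2]
        show (a - q, (0 : P')) ∈ N
        rw [this]
        exact N.add_mem hab hn
      · simp [hcd.1, hq']
    have h1' : ∀ p, (p, (0 : P')) ∈ N := fun p ↦ by
      have hp : p ∈ Submodule.comap (LinearMap.inl R P P') N := by rw [h1]; trivial
      exact hp
    intro p p' _ hp'
    obtain ⟨n, hn, w, ⟨q, _, rfl⟩, hnq⟩ := Submodule.mem_sup.1 (h2 p' hp')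
    have : (p, p') = n + (p + q, 0) := by
      have e : n = (0, p') - LinearMap.inl R P P' q := by rw [← hnq]; abel
      rw [e]
      ext <;> simp
    rw [this]
    exact N.add_mem hn (h1' _)
  rw [eq_top_iff, ← hN]
  refine sup_le le_rfl ?_
  rintro ⟨p, p'⟩ hp
  simp only [LinearMap.mem_ker, LinearMap.prodMap_apply, Prod.mk_eq_zero] at hp
  exact key p p' hp.1 hp.2

variable [IsArtinianRing R]

/-- Over a left artinian ring every finitely generated module has a projective cover, given by a
finitely generated projective module of minimal length surjecting onto it. -/
theorem exists_isProjectiveCover (M : FGModuleCat.{u} R) :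
    ∃ (P : FGModuleCat.{u} R) (f : P →ₗ[R] M), IsProjectiveCover f := by
  let S : Set (FGModuleCat.{u} R) :=
    {P | Module.Projective R P ∧ ∃ f : P →ₗ[R] M, Function.Surjective f}
  have hS : S.Nonempty := by
    obtain ⟨n, f, hf⟩ := Module.Finite.exists_fin' R M
    exact ⟨FGModuleCat.of R (Fin n → R), inferInstanceAs (Module.Projective R (Fin n → R)), f, hf⟩
  obtain ⟨P, ⟨hP, f, hf⟩, hmin⟩ :=
    (InvImage.wf (fun P : FGModuleCat.{u} R ↦ Module.length R P) wellFounded_lt).has_min S hS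
  refine ⟨P, f, hP, hf, fun N hN ↦ ?_⟩
  have hfN : Function.Surjective (f ∘ₗ N.subtype) := by
    intro y
    obtain ⟨x, rfl⟩ := hf y
    have hx : x ∈ N ⊔ LinearMap.ker f := by rw [hN]; trivial
    obtain ⟨a, ha, b, hb, rfl⟩ := Submodule.mem_sup.1 hx
    have hb' : f b = 0 := hb
    exact ⟨⟨a, ha⟩, by simp [hb']⟩
  obtain ⟨g, hg⟩ := Module.projective_lifting_property (f ∘ₗ N.subtype) f hfN
  let h : Module.End R P := N.subtype ∘ₗ g
  have hfh : ∀ x, f (h x) = f x := fun x ↦ LinearMap.congr_fun hg x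
  have hfhn : ∀ n x, f ((h ^ n) x) = f x := by
    intro n
    induction n with
    | zero => simp
    | succ n ih => intro x; rw [pow_succ, Module.End.mul_apply, ih, hfh]
  obtain ⟨n, hn⟩ := Filter.eventually_atTop.1 (LinearMap.eventually_isCompl_ker_pow_range_pow h)
  have hc := hn (n + 1) (Nat.le_succ n)
  have hproj : Module.Projective R (LinearMap.range (h ^ (n + 1))) := by
    refine Module.Projective.of_split (Submodule.subtype _)
      (Submodule.projectionOnto _ _ hc.symm) ?_
    ext x
    simp
  have hr : LinearMap.range (h ^ (n + 1)) = ⊤ := by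
    by_contra hne
    refine hmin (FGModuleCat.of R (LinearMap.range (h ^ (n + 1))))
      ⟨hproj, f ∘ₗ Submodule.subtype _, ?_⟩ (Submodule.length_lt hne)
    intro y
    obtain ⟨x, rfl⟩ := hf y
    exact ⟨⟨_, x, rfl⟩, hfhn (n + 1) x⟩
  rw [eq_top_iff, ← hr]
  rintro _ ⟨x, rfl⟩
  rw [pow_succ', Module.End.mul_apply]
  exact (g _).2

/-- The projective cover `P(M)` of `M`. -/
noncomputable def projCover (M : FGModuleCat.{u} R) : FGModuleCat.{u} R :=
  (exists_isProjectiveCover M).choose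

/-- The projective cover map `P(M) → M`. -/
noncomputable def projCoverMap (M : FGModuleCat.{u} R) : projCover M →ₗ[R] M :=
  (exists_isProjectiveCover M).choose_spec.choose

theorem isProjectiveCover_projCoverMap (M : FGModuleCat.{u} R) :
    IsProjectiveCover (projCoverMap M) :=
  (exists_isProjectiveCover M).choose_spec.choose_spec

/-- The first syzygy `Ω M`: the kernel of the projective cover of `M`. -/
noncomputable def syzygy (M : FGModuleCat.{u} R) : FGModuleCat.{u} R :=
  FGModuleCat.of R (LinearMap.ker (projCoverMap M))

/-- The iterated syzygy `Ωⁿ M`. -/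
noncomputable def iterSyzygy (n : ℕ) (M : FGModuleCat.{u} R) : FGModuleCat.{u} R :=
  syzygy^[n] M

/-- `Ω (A ⊕ B) ≃ Ω A ⊕ Ω B`. -/
theorem nonempty_syzygy_prod {A B C : FGModuleCat.{u} R} (e : C ≃ₗ[R] (A × B)) :
    Nonempty (syzygy C ≃ₗ[R] (syzygy A × syzygy B)) := by
  obtain ⟨E⟩ := (isProjectiveCover_projCoverMap C).nonempty_ker_equiv
    ((isProjectiveCover_projCoverMap A).prodMap (isProjectiveCover_projCoverMap B)) e
  let F : LinearMap.ker ((projCoverMap A).prodMap (projCoverMap B)) ≃ₗ[R]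
      (LinearMap.ker (projCoverMap A) × LinearMap.ker (projCoverMap B)) :=
    { toFun := fun x ↦ (⟨x.1.1, congrArg Prod.fst x.2⟩, ⟨x.1.2, congrArg Prod.snd x.2⟩)
      invFun := fun y ↦ ⟨(y.1.1, y.2.1), Prod.ext y.1.2 y.2.2⟩
      map_add' := fun _ _ ↦ rfl
      map_smul' := fun _ _ ↦ rfl
      left_inv := fun _ ↦ rfl
      right_inv := fun _ ↦ rfl }
  exact ⟨E.trans F⟩

theorem syzygy_projective {P : FGModuleCat.{u} R} (hP : Module.Projective R P) :
    Module.Projective R (syzygy P) := by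
  have h : IsProjectiveCover (LinearMap.id : P →ₗ[R] P) :=
    ⟨hP, Function.surjective_id, fun N hN ↦ by simpa using hN⟩
  obtain ⟨E⟩ := (isProjectiveCover_projCoverMap P).nonempty_ker_equiv h (LinearEquiv.refl R P)
  have : Subsingleton (LinearMap.ker (LinearMap.id : P →ₗ[R] P)) := by
    rw [LinearMap.ker_id]; infer_instance
  have : Subsingleton (syzygy P) := E.toEquiv.subsingleton
  infer_instance

/-- The endomorphism of `𝒦` induced by the syzygy, `Ω [M] = [Ω M]`. -/
noncomputable def omega (R : Type u) [Ring R] [IsArtinianRing R] :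
    StableGroup R →+ StableGroup R :=
  QuotientAddGroup.lift (AddSubgroup.closure (stableRelations R))
    (FreeAbelianGroup.lift fun M : FGModuleCat.{u} R ↦ cls (syzygy M)) <| by
      rw [AddSubgroup.closure_le]
      rintro _ (⟨A, B, C, ⟨e⟩, rfl⟩ | ⟨P, hP, rfl⟩)
      · obtain ⟨E⟩ := nonempty_syzygy_prod e
        simp [AddMonoidHom.mem_ker, cls_add E]
      · simp [AddMonoidHom.mem_ker, cls_projective (syzygy_projective hP)]

theorem omega_cls (M : FGModuleCat.{u} R) : omega R (cls M) = cls (syzygy M) :=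
  (QuotientAddGroup.lift_mk _ _ _).trans (FreeAbelianGroup.lift_apply_of _ _)

/-- The subgroup `Ωᵐ⟨M⟩` of `𝒦`, the `m`-fold image of `⟨M⟩` under `Ω`. -/
noncomputable def omegaSummandGroup (m : ℕ) (M : FGModuleCat.{u} R) :
    AddSubgroup (StableGroup R) :=
  (AddSubgroup.map (omega R))^[m] (summandGroup M)

/-- `Φ(M)`: the smallest `n` such that `Ω : Ωᵐ⟨M⟩ → Ωᵐ⁺¹⟨M⟩` is bijective for all `m ≥ n`.
Such `n` exists: `⟨M⟩` is a finitely generated abelian group, so the kernels of `Ωᵐ` on it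
stabilize. -/
noncomputable def phi (M : FGModuleCat.{u} R) : ℕ :=
  sInf {n | ∀ m ≥ n, Set.BijOn (omega R) (omegaSummandGroup m M) (omegaSummandGroup (m + 1) M)}

/-- The Igusa–Todorov function `Ψ(M) = Φ(M) + pfd 𝒞_M`, where `𝒞_M` is the set of direct summands of
`Ω^Φ(M) M`. The supremum `pfd 𝒞_M` is finite, as that module has only finitely many indecomposable
direct summands up to isomorphism. -/
noncomputable def psi (M : FGModuleCat.{u} R) : ℕ :=
  phi M + (pfd {X | IsDirectSummand X (iterSyzygy (phi M) M)}).toNat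

/-- The `Ψ`-dimension of a class of modules. -/
noncomputable def psiDim (C : Set (FGModuleCat.{u} R)) : ℕ∞ :=
  ⨆ M ∈ C, (psi M : ℕ∞)

end ProjectiveCover

end StratSys

/-! Let `M` be filtered by `θ`. Since `Ext¹(θ(j), θ(i)) = 0` for `j ≥ i`, a factor of larger or
equal index lying above one of smaller index splits off and can be moved below it. So the factors
`θ(j)` with `j > i₀` can be collected in a submodule `A` and those with `j < i₀` in a quotient `Q`.
What remains between them is a module `T` built from copies of `θ(i₀)`, which split because
`Ext¹(θ(i₀), θ(i₀)) = 0`. This is `IsStratifyingSystem.exists_rearrangement`.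

Here `A` and `Q` have projective dimension at most `s`, so by the horseshoe lemma they disappear
from the `(s + 1)`-st syzygy up to projective summands. Hence `Ωˢ⁺¹ M` lies in the additive closure
(`StableAdd`) of `Ωˢ⁺¹ θ(i₀)` and the projectives, and conversely if `T ≠ 0`. For (a): if `T = 0`
then `pd M ≤ s`; otherwise finite `pd M` would force finite `pd θ(i₀)`.

For (b), `Ψ(M) ≤ n + Ψ(Ωⁿ M)` is applied with `n = s + 1`. By Krull–Schmidt, `Ψ` is monotone for
`StableAdd` (`StableAdd.psi_le`): indecomposable summands of a module in the closure of `V` are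
projective, hence invisible to `Ψ`, or summands of `V`. -/

namespace StratSys

universe u

/-! ### Extensions: splitting and regrouping -/

section Extensions

variable {R : Type u} [Ring R]

/-- `B` is an extension of `C` by `A`: there is a short exact sequence `0 → A → B → C → 0`. -/
def IsExtension (A B C : FGModuleCat.{u} R) : Prop :=
  ∃ (f : A →ₗ[R] B) (g : B →ₗ[R] C),
    Function.Injective f ∧ Function.Exact f g ∧ Function.Surjective g

theorem IsExtension.exists_shortExact {A B C : FGModuleCat.{u} R} (h : IsExtension A B C) :
    ∃ (f : A.obj ⟶ B.obj) (g : B.obj ⟶ C.obj) (w : f ≫ g = 0),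
      (ShortComplex.mk f g w).ShortExact := by
  obtain ⟨f, g, hf, hfg, hg⟩ := h
  refine ⟨ModuleCat.ofHom f, ModuleCat.ofHom g, ?_, ?_⟩
  · ext x
    exact hfg.apply_apply_eq_zero x
  · exact
      { exact := (ShortComplex.ShortExact.moduleCat_exact_iff_function_exact _).2 hfg
        mono_f := (ModuleCat.mono_iff_injective _).2 hf
        epi_g := (ModuleCat.epi_iff_surjective _).2 hg }

theorem nonempty_equiv_prod_of_section {A B C : FGModuleCat.{u} R} {f : A →ₗ[R] B}
    {g : B →ₗ[R] C} (hf : Function.Injective f) (hfg : Function.Exact f g) (l : C →ₗ[R] B)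
    (hl : g ∘ₗ l = LinearMap.id) : Nonempty (B ≃ₗ[R] (A × C)) :=
  ⟨(hfg.splitSurjectiveEquiv hf ⟨l, hl⟩).1⟩

/-- An extension of a projective module splits. -/
theorem IsExtension.split_of_projective {A B C : FGModuleCat.{u} R} (h : IsExtension A B C)
    (hC : Module.Projective R C) : Nonempty (B ≃ₗ[R] (A × C)) := by
  obtain ⟨f, g, hf, hfg, hg⟩ := h
  obtain ⟨l, hl⟩ := Module.projective_lifting_property g LinearMap.id hg
  exact nonempty_equiv_prod_of_section hf hfg l hl

/-- If `Ext¹(C, A) = 0`, then every extension of `C` by `A` splits. -/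
theorem IsExtension.split_of_ext {A B C : FGModuleCat.{u} R} (h : IsExtension A B C)
    (hC : Subsingleton (Abelian.Ext.{u} C.obj A.obj 1)) : Nonempty (B ≃ₗ[R] (A × C)) := by
  obtain ⟨f, g, w, hS⟩ := h.exists_shortExact
  -- The obstruction to lifting the identity of `C` along `g` lies in `Ext¹(C, A) = 0`.
  obtain ⟨x, hx⟩ := Abelian.Ext.covariant_sequence_exact₃ C.obj hS
    (Abelian.Ext.mk₀ (𝟙 C.obj)) (zero_add 1) (hC.elim _ _)
  obtain ⟨l, rfl⟩ := Abelian.Ext.mk₀_bijective _ _ |>.2 x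
  rw [Abelian.Ext.mk₀_comp_mk₀] at hx
  have hl : l ≫ g = 𝟙 C.obj := (Abelian.Ext.mk₀_bijective _ _).1 hx
  exact nonempty_equiv_prod_of_section (f := f.hom) (g := g.hom) hS.moduleCat_injective_f
    ((ShortComplex.ShortExact.moduleCat_exact_iff_function_exact _).1 hS.exact) l.hom
    (by rw [← ModuleCat.hom_comp, hl, ModuleCat.hom_id])

/-- Exactness of the long `Ext` sequence at its middle term. It keeps the vanishing of `Ext¹(θ(j),
-)` alive while a filtration grows. -/
theorem IsExtension.subsingleton_ext {A B C X : FGModuleCat.{u} R} (h : IsExtension A B C)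
    (hA : Subsingleton (Abelian.Ext.{u} X.obj A.obj 1))
    (hC : Subsingleton (Abelian.Ext.{u} X.obj C.obj 1)) :
    Subsingleton (Abelian.Ext.{u} X.obj B.obj 1) := by
  obtain ⟨f, g, w, hS⟩ := h.exists_shortExact
  refine subsingleton_of_forall_eq 0 fun x ↦ ?_
  obtain ⟨y, rfl⟩ := Abelian.Ext.covariant_sequence_exact₂ X.obj hS x (hC.elim _ _)
  rw [hA.elim y 0, Abelian.Ext.zero_comp]

theorem IsExtension.equiv_middle {A B B' C : FGModuleCat.{u} R} (h : IsExtension A B C)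
    (e : B ≃ₗ[R] B') : IsExtension A B' C := by
  obtain ⟨f, g, hf, hfg, hg⟩ := h
  refine ⟨e.toLinearMap ∘ₗ f, g ∘ₗ e.symm.toLinearMap, e.injective.comp hf, fun y ↦ ?_,
    hg.comp e.symm.surjective⟩
  have := hfg (e.symm y)
  simp only [LinearMap.comp_apply, LinearEquiv.coe_coe, this, Set.mem_range]
  exact exists_congr fun x ↦ by rw [LinearEquiv.eq_symm_apply]

theorem exists_comp_eq_of_ker_le {N E Z : Type*} [AddCommGroup N] [AddCommGroup E]
    [AddCommGroup Z] [Module R N] [Module R E] [Module R Z] {g : N →ₗ[R] E}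
    (hg : Function.Surjective g) (h : N →ₗ[R] Z) (hk : LinearMap.ker g ≤ LinearMap.ker h) :
    ∃ h' : E →ₗ[R] Z, ∀ x, h' (g x) = h x := by
  refine ⟨(LinearMap.ker g).liftQ h hk ∘ₗ (g.quotKerEquivOfSurjective hg).symm.toLinearMap,
    fun x ↦ ?_⟩
  have : (g.quotKerEquivOfSurjective hg).symm (g x) = (LinearMap.ker g).mkQ x := by
    rw [LinearEquiv.symm_apply_eq]
    rfl
  simp [this]

/-- An iterated extension, regrouped: for `A ⊆ N ⊆ M` the quotient `M / A` is an extension of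
`M / N` by `N / A`. -/
theorem IsExtension.assoc {A N E M X : FGModuleCat.{u} R} (h₁ : IsExtension A N E)
    (h₂ : IsExtension N M X) :
    ∃ E' : FGModuleCat.{u} R, IsExtension A M E' ∧ IsExtension E E' X := by
  obtain ⟨f, g, hf, hfg, hg⟩ := h₁
  obtain ⟨i, p, hi, hip, hp⟩ := h₂
  -- `K` is the copy of `A` in `M`, and `E'` will be `M / K`.
  let K := LinearMap.range (i ∘ₗ f)
  have hker : LinearMap.ker g ≤ LinearMap.ker (K.mkQ ∘ₗ i) := by
    intro x hx
    obtain ⟨a, rfl⟩ := (hfg x).1 hx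
    exact (Submodule.Quotient.mk_eq_zero _).2 ⟨a, rfl⟩
  obtain ⟨i', hi'⟩ := exists_comp_eq_of_ker_le hg _ hker
  have hK : K ≤ LinearMap.ker p := by
    rintro _ ⟨a, rfl⟩
    exact hip.apply_apply_eq_zero (f a)
  refine ⟨FGModuleCat.of R (M ⧸ K), ⟨i ∘ₗ f, K.mkQ, hi.comp hf, ?_, K.mkQ_surjective⟩,
    i', K.liftQ p hK, ?_, ?_, ?_⟩
  · intro x
    exact Submodule.Quotient.mk_eq_zero K
  · rw [← LinearMap.ker_eq_bot, LinearMap.ker_eq_bot']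
    intro y hy
    obtain ⟨x, rfl⟩ := hg y
    rw [hi'] at hy
    obtain ⟨a, ha⟩ := (Submodule.Quotient.mk_eq_zero K).1 hy
    rw [← hi ha]
    exact hfg.apply_apply_eq_zero a
  · intro y
    obtain ⟨m, rfl⟩ := K.mkQ_surjective y
    constructor
    · intro hm
      obtain ⟨n, rfl⟩ := (hip m).1 hm
      exact ⟨g n, hi' n⟩
    · rintro ⟨z, hz⟩
      obtain ⟨n, rfl⟩ := hg z
      rw [← hz, hi']
      exact hip.apply_apply_eq_zero n
  · intro x
    obtain ⟨m, rfl⟩ := hp x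
    exact ⟨K.mkQ m, rfl⟩

end Extensions

/-! ### Preimages of summands, and Schanuel's lemma -/

section Noetherian

variable {R : Type u} [Ring R] [IsNoetherianRing R]

/-- If `M / A ≃ E × X`, then `M` is an extension of `E` by an extension of `X` by `A`. -/
theorem IsExtension.exists_of_prod {A M E' E X : FGModuleCat.{u} R} (h : IsExtension A M E')
    (e : E' ≃ₗ[R] (E × X)) :
    ∃ A' : FGModuleCat.{u} R, IsExtension A A' X ∧ IsExtension A' M E := by
  obtain ⟨f, g, hf, hfg, hg⟩ := h
  -- The kernel of `φ` is the preimage of `X` in `M`; it serves as `A'`.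
  let φ : M →ₗ[R] E := LinearMap.fst R E X ∘ₗ e.toLinearMap ∘ₗ g
  have hφ : ∀ a, φ (f a) = 0 := fun a ↦ by
    simp [φ, hfg.apply_apply_eq_zero a]
  refine ⟨FGModuleCat.of R (LinearMap.ker φ),
    ⟨f.codRestrict _ hφ, LinearMap.snd R E X ∘ₗ e.toLinearMap ∘ₗ g ∘ₗ Submodule.subtype _,
      ?_, ?_, ?_⟩, Submodule.subtype _, φ, Subtype.val_injective, ?_, ?_⟩
  · intro a b hab
    exact hf (congrArg Subtype.val hab)
  · rintro ⟨m, hm⟩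
    have hm' : (e (g m)).1 = 0 := hm
    constructor
    · intro h2
      have h2' : (e (g m)).2 = 0 := h2
      have h0 : g m = 0 := by
        rw [← e.map_eq_zero_iff]
        exact Prod.ext hm' h2'
      obtain ⟨a, ha⟩ := (hfg m).1 h0
      exact ⟨a, Subtype.ext ha⟩
    · rintro ⟨a, ha⟩
      have ha' : f a = m := congrArg Subtype.val ha
      change (e (g m)).2 = 0
      rw [← ha', hfg.apply_apply_eq_zero, map_zero]
      rfl
  · intro x
    obtain ⟨m, hm⟩ := hg (e.symm (0, x))
    refine ⟨⟨m, ?_⟩, ?_⟩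
    · change (e (g m)).1 = 0
      simp [hm]
    · change (e (g m)).2 = x
      simp [hm]
  · intro m
    exact ⟨fun hm ↦ ⟨⟨m, hm⟩, rfl⟩, fun ⟨x, hx⟩ ↦ hx ▸ x.2⟩
  · exact (LinearMap.fst_surjective (R := R) (M := E) (M₂ := X)).comp (e.surjective.comp hg)

/-- Schanuel's lemma. -/
theorem nonempty_ker_prod_equiv {P Q M : FGModuleCat.{u} R} (hP : Module.Projective R P)
    (hQ : Module.Projective R Q) {p : P →ₗ[R] M} {q : Q →ₗ[R] M} (hp : Function.Surjective p)
    (hq : Function.Surjective q) :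
    Nonempty ((LinearMap.ker p × Q) ≃ₗ[R] (LinearMap.ker q × P)) := by
  -- The pullback of `p` and `q`: it projects onto both `P` and `Q`, and both projections split.
  let W : Submodule R (P × Q) :=
    LinearMap.ker (p ∘ₗ LinearMap.fst R P Q - q ∘ₗ LinearMap.snd R P Q)
  have hW : ∀ w : P × Q, w ∈ W ↔ p w.1 = q w.2 := fun w ↦ by simp [W, sub_eq_zero]
  have h₁ : IsExtension (FGModuleCat.of R (LinearMap.ker p)) (FGModuleCat.of R W) Q := by
    refine ⟨LinearMap.codRestrict W (LinearMap.inl R P Q ∘ₗ Submodule.subtype _) ?_,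
      LinearMap.snd R P Q ∘ₗ W.subtype, ?_, ?_, ?_⟩
    · rintro ⟨x, hx⟩
      rw [hW]
      simpa using hx
    · intro x y hxy
      exact Subtype.ext (congrArg (fun w ↦ w.1.1) hxy)
    · rintro ⟨⟨x, y⟩, hxy⟩
      constructor
      · intro hy
        have hy : y = 0 := hy
        subst hy
        refine ⟨⟨x, ?_⟩, rfl⟩
        simpa using (hW _).1 hxy
      · rintro ⟨z, hz⟩
        exact (congrArg (fun w ↦ w.1.2) hz).symm
    · intro y
      obtain ⟨x, hx⟩ := hp (q y)
      exact ⟨⟨(x, y), (hW _).2 hx⟩, rfl⟩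
  have h₂ : IsExtension (FGModuleCat.of R (LinearMap.ker q)) (FGModuleCat.of R W) P := by
    refine ⟨LinearMap.codRestrict W (LinearMap.inr R P Q ∘ₗ Submodule.subtype _) ?_,
      LinearMap.fst R P Q ∘ₗ W.subtype, ?_, ?_, ?_⟩
    · rintro ⟨x, hx⟩
      rw [hW]
      simpa [eq_comm] using hx
    · intro x y hxy
      exact Subtype.ext (congrArg (fun w ↦ w.1.2) hxy)
    · rintro ⟨⟨x, y⟩, hxy⟩
      constructor
      · intro hx
        have hx : x = 0 := hx
        subst hx
        refine ⟨⟨y, ?_⟩, rfl⟩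
        simpa using (hW (0, y)).1 hxy |>.symm
      · rintro ⟨z, hz⟩
        exact (congrArg (fun w ↦ w.1.1) hz).symm
    · intro x
      obtain ⟨y, hy⟩ := hq (p x)
      exact ⟨⟨(x, y), (hW _).2 hy.symm⟩, rfl⟩
  obtain ⟨e₁⟩ := h₁.split_of_projective hQ
  obtain ⟨e₂⟩ := h₂.split_of_projective hP
  exact ⟨e₁.symm.trans e₂⟩

end Noetherian

/-! ### Projective dimension and dimension shifting -/

section ProjectiveDimension

variable {R : Type u} [Ring R]

/-- Replacing the value `⊥` by `0` on zero modules does not affect upper bounds by natural numbers.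
-/
theorem pd_le_iff_hasProjectiveDimensionLE {M : FGModuleCat.{u} R} {n : ℕ} :
    pd M ≤ n ↔ HasProjectiveDimensionLE M.obj n := by
  rw [← projectiveDimension_le_iff, pd, WithBot.unbotD_le_iff fun _ ↦ zero_le]
  rfl

theorem IsExtension.pd_le {A B C : FGModuleCat.{u} R} (h : IsExtension A B C) {n : ℕ}
    (hA : pd A ≤ n) (hC : pd C ≤ n) : pd B ≤ n := by
  rw [pd_le_iff_hasProjectiveDimensionLE] at hA hC ⊢
  obtain ⟨f, g, w, hS⟩ := h.exists_shortExact
  exact hS.hasProjectiveDimensionLT_X₂ (n + 1) hA hC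

theorem pd_le_zero_iff {M : FGModuleCat.{u} R} : pd M ≤ 0 ↔ Module.Projective R M := by
  rw [← Nat.cast_zero, pd_le_iff_hasProjectiveDimensionLE,
    ← projective_iff_hasProjectiveDimensionLE_zero]
  exact (IsProjective.iff_projective (R := R) M).symm

theorem projective_prod_iff {A B C : FGModuleCat.{u} R} (e : C ≃ₗ[R] (A × B)) :
    Module.Projective R C ↔ Module.Projective R A ∧ Module.Projective R B := by
  constructor
  · intro h
    have := Module.Projective.of_equiv e
    exact ⟨Module.Projective.of_split (LinearMap.inl R A B) (LinearMap.fst R A B) (by ext; simp),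
      Module.Projective.of_split (LinearMap.inr R A B) (LinearMap.snd R A B) (by ext; simp)⟩
  · rintro ⟨_, _⟩
    exact Module.Projective.of_equiv e.symm

theorem pd_le_of_equiv {A B : FGModuleCat.{u} R} (e : A ≃ₗ[R] B) {n : ℕ} (h : pd B ≤ n) :
    pd A ≤ n := by
  rw [pd_le_iff_hasProjectiveDimensionLE] at h ⊢
  exact hasProjectiveDimensionLT_of_iso e.symm.toModuleIso _

variable [IsArtinianRing R]

theorem isExtension_syzygy (M : FGModuleCat.{u} R) : IsExtension (syzygy M) (projCover M) M :=
  ⟨Submodule.subtype _, projCoverMap M, Subtype.val_injective,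
    LinearMap.exact_subtype_ker_map _, (isProjectiveCover_projCoverMap M).surjective⟩

theorem pd_syzygy_le_iff {M : FGModuleCat.{u} R} {n : ℕ} :
    pd (syzygy M) ≤ n ↔ pd M ≤ (n + 1 : ℕ) := by
  rw [pd_le_iff_hasProjectiveDimensionLE, pd_le_iff_hasProjectiveDimensionLE]
  obtain ⟨f, g, w, hS⟩ := (isExtension_syzygy M).exists_shortExact
  have hP : Projective (projCover M).obj := (IsProjective.iff_projective (R := R) (projCover M)).1
    (isProjectiveCover_projCoverMap M).projective
  exact (hS.hasProjectiveDimensionLT_X₃_iff n hP).symm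

theorem iterSyzygy_add (m n : ℕ) (M : FGModuleCat.{u} R) :
    iterSyzygy (m + n) M = iterSyzygy m (iterSyzygy n M) :=
  Function.iterate_add_apply _ _ _ _

theorem pd_iterSyzygy_le_iff {M : FGModuleCat.{u} R} {n q : ℕ} :
    pd (iterSyzygy q M) ≤ n ↔ pd M ≤ (n + q : ℕ) := by
  induction q generalizing M with
  | zero => rfl
  | succ q ih =>
    rw [iterSyzygy_add, ih]
    exact pd_syzygy_le_iff

theorem pd_le_iff_projective {M : FGModuleCat.{u} R} {n : ℕ} :
    pd M ≤ n ↔ Module.Projective R (iterSyzygy n M) := by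
  rw [← pd_le_zero_iff, ← Nat.cast_zero, pd_iterSyzygy_le_iff, zero_add]

theorem nonempty_iterSyzygy_prod {A B C : FGModuleCat.{u} R} (e : C ≃ₗ[R] (A × B)) (n : ℕ) :
    Nonempty (iterSyzygy n C ≃ₗ[R] (iterSyzygy n A × iterSyzygy n B)) := by
  induction n generalizing A B C with
  | zero => exact ⟨e⟩
  | succ n ih =>
    obtain ⟨E⟩ := nonempty_syzygy_prod e
    exact ih E

theorem pd_prod_le_iff {A B C : FGModuleCat.{u} R} (e : C ≃ₗ[R] (A × B)) {n : ℕ} :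
    pd C ≤ n ↔ pd A ≤ n ∧ pd B ≤ n := by
  obtain ⟨E⟩ := nonempty_iterSyzygy_prod e n
  simp only [pd_le_iff_projective, projective_prod_iff E]

end ProjectiveDimension

end StratSys

namespace StratSys

universe u

/-! ### Direct summands -/

section DirectSummands

variable {R : Type u} [Ring R]

theorem IsDirectSummand.exists_retraction {X M : FGModuleCat.{u} R} (h : IsDirectSummand X M) :
    ∃ (i : X →ₗ[R] M) (r : M →ₗ[R] X), r ∘ₗ i = LinearMap.id := by
  obtain ⟨Y, ⟨e⟩⟩ := h
  exact ⟨e.symm.toLinearMap ∘ₗ LinearMap.inl R X Y, LinearMap.fst R X Y ∘ₗ e.toLinearMap,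
    by ext; simp⟩

theorem IsDirectSummand.of_retraction [IsNoetherianRing R] {X M : FGModuleCat.{u} R}
    (i : X →ₗ[R] M) (r : M →ₗ[R] X) (h : r ∘ₗ i = LinearMap.id) : IsDirectSummand X M := by
  have hr : Function.Surjective r := fun x ↦ ⟨i x, LinearMap.congr_fun h x⟩
  obtain ⟨e⟩ := nonempty_equiv_prod_of_section (A := FGModuleCat.of R (LinearMap.ker r))
    (f := Submodule.subtype _) Subtype.val_injective (LinearMap.exact_subtype_ker_map r) i h
  exact ⟨_, ⟨e.trans (LinearEquiv.prodComm R _ _)⟩⟩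

theorem IsDirectSummand.trans [IsNoetherianRing R] {X Y Z : FGModuleCat.{u} R}
    (h₁ : IsDirectSummand X Y) (h₂ : IsDirectSummand Y Z) : IsDirectSummand X Z := by
  obtain ⟨i, r, h⟩ := h₁.exists_retraction
  obtain ⟨j, q, h'⟩ := h₂.exists_retraction
  refine .of_retraction (j ∘ₗ i) (r ∘ₗ q) (LinearMap.ext fun x ↦ ?_)
  have h1 : q (j (i x)) = i x := LinearMap.congr_fun h' (i x)
  have h2 : r (i x) = x := LinearMap.congr_fun h x
  simp [h1, h2]

theorem isDirectSummand_left {A B C : FGModuleCat.{u} R} (e : C ≃ₗ[R] (A × B)) :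
    IsDirectSummand A C := ⟨B, ⟨e⟩⟩

theorem isDirectSummand_right {A B C : FGModuleCat.{u} R} (e : C ≃ₗ[R] (A × B)) :
    IsDirectSummand B C := ⟨A, ⟨e.trans (LinearEquiv.prodComm R _ _)⟩⟩

theorem isDirectSummand_self (M : FGModuleCat.{u} R) : IsDirectSummand M M :=
  ⟨FGModuleCat.of R PUnit, ⟨(LinearEquiv.prodUnique (R := R) (M := M) (M₂ := PUnit.{u + 1})).symm⟩⟩

theorem IsDirectSummand.projective {X P : FGModuleCat.{u} R} (h : IsDirectSummand X P)
    (hP : Module.Projective R P) : Module.Projective R X := by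
  obtain ⟨Y, ⟨e⟩⟩ := h
  exact ((projective_prod_iff e).1 hP).1

theorem cls_eq_of_equiv {A B : FGModuleCat.{u} R} (e : A ≃ₗ[R] B) : cls A = cls B := by
  have h := cls_add (A := B) (B := FGModuleCat.of R PUnit)
    (e.trans (LinearEquiv.prodUnique (R := R) (M := B) (M₂ := PUnit.{u + 1})).symm)
  rwa [cls_projective (P := FGModuleCat.of R PUnit)
    (inferInstanceAs (Module.Projective R PUnit.{u + 1})), add_zero] at h

/-- A nonzero direct summand of an indecomposable module is the whole module. -/
theorem IsIndecomposable.nonempty_equiv {X M : FGModuleCat.{u} R} (hM : IsIndecomposable M)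
    (hX : Nontrivial X) (h : IsDirectSummand X M) : Nonempty (X ≃ₗ[R] M) := by
  obtain ⟨Y, ⟨e⟩⟩ := h
  have hc : IsCompl ((LinearMap.range (LinearMap.inl R X Y)).map e.symm.toLinearMap)
      ((LinearMap.range (LinearMap.inr R X Y)).map e.symm.toLinearMap) :=
    (LinearMap.isCompl_range_inl_inr (R := R) (M := X) (M₂ := Y)).map
      (Submodule.orderIsoMapComap e.symm)
  rcases hM.2 _ _ hc with h | h
  · obtain ⟨x, hx⟩ := exists_ne (0 : X)
    rw [Submodule.map_eq_bot_iff, LinearMap.range_eq_bot] at h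
    exact absurd (congrArg Prod.fst (LinearMap.congr_fun h x)) hx
  · rw [Submodule.map_eq_bot_iff, LinearMap.range_eq_bot] at h
    have : Subsingleton Y := subsingleton_of_forall_eq 0 fun y ↦
      congrArg Prod.snd (LinearMap.congr_fun h y)
    have : Unique Y := ⟨⟨0⟩, fun y ↦ Subsingleton.elim _ _⟩
    exact ⟨(e.trans LinearEquiv.prodUnique).symm⟩

theorem not_isIndecomposable_of_subsingleton {X M : FGModuleCat.{u} R} (hM : Subsingleton M)
    (h : IsDirectSummand X M) : ¬ IsIndecomposable X := by
  intro hX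
  obtain ⟨i, r, hri⟩ := h.exists_retraction
  have hi : Function.Injective i := Function.LeftInverse.injective (LinearMap.congr_fun hri)
  exact not_subsingleton_iff_nontrivial.2 hX.1 hi.subsingleton

theorem pd_le_pfd {C : Set (FGModuleCat.{u} R)} {X : FGModuleCat.{u} R} (hX : X ∈ C)
    (h : pd X ≠ ⊤) : pd X ≤ pfd C :=
  le_sSup ⟨h, X, hX, rfl⟩

end DirectSummands

/-! ### Fitting's lemma and Krull–Schmidt arguments -/

section KrullSchmidt

variable {R : Type u} [Ring R] [IsArtinianRing R]

/-- Fitting's lemma. -/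
theorem IsIndecomposable.isUnit_or_isNilpotent {X : FGModuleCat.{u} R} (hX : IsIndecomposable X)
    (f : Module.End R X) : IsUnit f ∨ IsNilpotent f := by
  obtain ⟨n, hn⟩ := Filter.eventually_atTop.1 (LinearMap.eventually_isCompl_ker_pow_range_pow f)
  have hc := hn (n + 1) (Nat.le_succ n)
  rcases hX.2 _ _ hc with h | h
  · left
    have hr : LinearMap.range (f ^ (n + 1)) = ⊤ := by
      rw [h] at hc
      exact eq_top_of_bot_isCompl hc
    have hu : IsUnit (f ^ (n + 1)) := by
      rw [Module.End.isUnit_iff]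
      exact ⟨LinearMap.ker_eq_bot.1 h, LinearMap.range_eq_top.1 hr⟩
    exact (isUnit_pow_iff n.succ_ne_zero).1 hu
  · exact Or.inr ⟨n + 1, LinearMap.range_eq_bot.1 h⟩

/-- An indecomposable direct summand of `A ⊕ B` is a direct summand of `A` or of `B`. -/
theorem IsIndecomposable.isDirectSummand_or {X A B C : FGModuleCat.{u} R}
    (hX : IsIndecomposable X) (e : C ≃ₗ[R] (A × B)) (h : IsDirectSummand X C) :
    IsDirectSummand X A ∨ IsDirectSummand X B := by
  obtain ⟨i, r, hri⟩ := h.exists_retraction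
  let iA : X →ₗ[R] A := LinearMap.fst R A B ∘ₗ e.toLinearMap ∘ₗ i
  let iB : X →ₗ[R] B := LinearMap.snd R A B ∘ₗ e.toLinearMap ∘ₗ i
  let rA : A →ₗ[R] X := r ∘ₗ e.symm.toLinearMap ∘ₗ LinearMap.inl R A B
  let rB : B →ₗ[R] X := r ∘ₗ e.symm.toLinearMap ∘ₗ LinearMap.inr R A B
  let f : Module.End R X := rA ∘ₗ iA
  let g : Module.End R X := rB ∘ₗ iB
  -- The identity `r ∘ i` of `X` is the sum of its parts through `A` and `B`. By Fitting's lemma one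
  -- of them is invertible, so `X` splits off that factor.
  have hfg : g = 1 - f := by
    rw [eq_sub_iff_add_eq, add_comm]
    ext x
    have : (LinearMap.inl R A B) (iA x) + (LinearMap.inr R A B) (iB x) = e (i x) := by
      simp [iA, iB]
    have h2 := congrArg (fun y ↦ r (e.symm y)) this
    rw [map_add, map_add, e.symm_apply_apply] at h2
    exact h2.trans (LinearMap.congr_fun hri x)
  have key : ∀ {D : FGModuleCat.{u} R} (j : X →ₗ[R] D) (q : D →ₗ[R] X),
      IsUnit (q ∘ₗ j : Module.End R X) → IsDirectSummand X D := by
    rintro D j q ⟨v, hv⟩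
    refine .of_retraction j ((v⁻¹ : (Module.End R X)ˣ).1 ∘ₗ q) ?_
    rw [LinearMap.comp_assoc, ← hv]
    exact v.inv_mul
  rcases hX.isUnit_or_isNilpotent f with hf | hf
  · exact Or.inl (key iA rA hf)
  · refine Or.inr (key iB rB ?_)
    change IsUnit g
    rw [hfg]
    exact hf.isUnit_one_sub

/-- Induction along decompositions into indecomposable direct summands. -/
theorem decomposition_induction {motive : FGModuleCat.{u} R → Prop}
    (zero : ∀ M : FGModuleCat.{u} R, Subsingleton M → motive M)
    (indecomposable : ∀ M, IsIndecomposable M → motive M)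
    (prod : ∀ (A B C : FGModuleCat.{u} R), (C ≃ₗ[R] (A × B)) → motive A → motive B → motive C)
    (M : FGModuleCat.{u} R) : motive M := by
  induction M using (InvImage.wf (fun P : FGModuleCat.{u} R ↦ Module.length R P)
    wellFounded_lt).induction with
  | _ M ih =>
  rcases subsingleton_or_nontrivial M with h | h
  · exact zero M h
  by_cases hM : IsIndecomposable M
  · exact indecomposable M hM
  · simp only [IsIndecomposable, h, true_and, not_forall, not_or] at hM
    obtain ⟨A, B, hAB, hA, hB⟩ := hM
    have lt : ∀ N : Submodule R M, N ≠ ⊤ → Module.length R N < Module.length R M :=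
      fun N hN ↦ Submodule.length_lt hN
    refine prod (FGModuleCat.of R A) (FGModuleCat.of R B) M
      (Submodule.prodEquivOfIsCompl A B hAB).symm (ih _ (lt A ?_)) (ih _ (lt B ?_))
    · rintro rfl
      exact hB (eq_bot_of_top_isCompl hAB)
    · rintro rfl
      exact hA (eq_bot_of_isCompl_top hAB)

/-- There are only finitely many classes of indecomposable direct summands of `M`. -/
theorem finite_cls_summands (M : FGModuleCat.{u} R) :
    {x | ∃ X, IsIndecomposable X ∧ IsDirectSummand X M ∧ cls X = x}.Finite := by
  induction M using decomposition_induction with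
  | zero M hM =>
    refine Set.finite_empty.subset ?_
    rintro x ⟨X, hX, h, -⟩
    exact not_isIndecomposable_of_subsingleton hM h hX
  | indecomposable M hM =>
    refine (Set.finite_singleton (cls M)).subset ?_
    rintro x ⟨X, hX, h, rfl⟩
    obtain ⟨e⟩ := hM.nonempty_equiv hX.1 h
    exact cls_eq_of_equiv e
  | prod A B C e hA hB =>
    refine (hA.union hB).subset ?_
    rintro x ⟨X, hX, h, rfl⟩
    exact (hX.isDirectSummand_or e h).imp (fun h ↦ ⟨X, hX, h, rfl⟩) (fun h ↦ ⟨X, hX, h, rfl⟩)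

theorem exists_pd_le_of_indecomposable_summands (M : FGModuleCat.{u} R) :
    ∃ b : ℕ, ∀ X, IsIndecomposable X → IsDirectSummand X M → pd X ≠ ⊤ → pd X ≤ b := by
  induction M using decomposition_induction with
  | zero M hM => exact ⟨0, fun X hX h ↦ absurd hX (not_isIndecomposable_of_subsingleton hM h)⟩
  | indecomposable M hM =>
    refine ⟨(pd M).toNat, fun X hX h hp ↦ ?_⟩
    obtain ⟨e⟩ := hM.nonempty_equiv hX.1 h
    obtain ⟨d, hd⟩ := ENat.ne_top_iff_exists.1 hp
    -- As `X ≃ M`, `pd M` is finite here, so `toNat` loses nothing.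
    have hM' : pd M ≤ d := pd_le_of_equiv e.symm hd.ge
    exact pd_le_of_equiv e (ENat.natCast_toNat (ne_top_of_le_ne_top (ENat.natCast_ne_top d) hM')).ge
  | prod A B C e hA hB =>
    obtain ⟨a, ha⟩ := hA
    obtain ⟨b, hb⟩ := hB
    refine ⟨max a b, fun X hX h hp ↦ ?_⟩
    rcases hX.isDirectSummand_or e h with h | h
    · exact (ha X hX h hp).trans (by simp)
    · exact (hb X hX h hp).trans (by simp)

theorem pd_le_of_indecomposable_summands {M : FGModuleCat.{u} R} {b : ℕ}
    (h : ∀ X, IsIndecomposable X → IsDirectSummand X M → pd X ≤ b) : pd M ≤ b := by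
  induction M using decomposition_induction with
  | zero M hM =>
    have : Module.Projective R M := inferInstance
    exact (pd_le_zero_iff.2 this).trans zero_le
  | indecomposable M hM => exact h M hM (isDirectSummand_self M)
  | prod A B C e hA hB =>
    exact (pd_prod_le_iff e).2
      ⟨hA fun X hX hXA ↦ h X hX (hXA.trans (isDirectSummand_left e)),
        hB fun X hX hXB ↦ h X hX (hXB.trans (isDirectSummand_right e))⟩

theorem IsDirectSummand.pd_le {X M : FGModuleCat.{u} R} (h : IsDirectSummand X M) {n : ℕ}
    (hM : pd M ≤ n) : pd X ≤ n := by
  obtain ⟨Y, ⟨e⟩⟩ := h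
  exact ((pd_prod_le_iff e).1 hM).1

theorem IsDirectSummand.iterSyzygy {X M : FGModuleCat.{u} R} (h : IsDirectSummand X M) (n : ℕ) :
    IsDirectSummand (iterSyzygy n X) (iterSyzygy n M) := by
  obtain ⟨Y, ⟨e⟩⟩ := h
  obtain ⟨E⟩ := nonempty_iterSyzygy_prod e n
  exact isDirectSummand_left E

/-- The supremum defining `Ψ` is finite. -/
theorem pfd_summands_ne_top (M : FGModuleCat.{u} R) : pfd {X | IsDirectSummand X M} ≠ ⊤ := by
  obtain ⟨b, hb⟩ := exists_pd_le_of_indecomposable_summands M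
  refine ne_top_of_le_ne_top (ENat.natCast_ne_top b) (sSup_le ?_)
  rintro d ⟨hd, X, hX, rfl⟩
  refine pd_le_of_indecomposable_summands fun Y hY hYX ↦ hb Y hY (hYX.trans hX) ?_
  obtain ⟨d, hd⟩ := ENat.ne_top_iff_exists.1 hd
  exact ne_top_of_le_ne_top (ENat.natCast_ne_top d) (hYX.pd_le hd.ge)

theorem cls_mem_summandGroup (M : FGModuleCat.{u} R) : cls M ∈ summandGroup M := by
  -- A fixed ambient `N` lets the induction pass to summands of `M`.
  suffices ∀ N : FGModuleCat.{u} R, IsDirectSummand M N → cls M ∈ summandGroup N from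
    this M (isDirectSummand_self M)
  induction M using decomposition_induction with
  | zero M hM =>
    intro N _
    rw [cls_projective (inferInstance : Module.Projective R M)]
    exact zero_mem _
  | indecomposable M hM => exact fun N h ↦ AddSubgroup.subset_closure ⟨M, hM, h, rfl⟩
  | prod A B C e hA hB =>
    intro N h
    rw [cls_add e]
    exact add_mem (hA N ((isDirectSummand_left e).trans h))
      (hB N ((isDirectSummand_right e).trans h))

theorem summandGroup_mono {M N : FGModuleCat.{u} R} (h : IsDirectSummand M N) :
    summandGroup M ≤ summandGroup N :=
  AddSubgroup.closure_mono fun _ ⟨X, hX, hXM, hx⟩ ↦ ⟨X, hX, hXM.trans h, hx⟩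

end KrullSchmidt

end StratSys

namespace StratSys

universe u

/-! ### Additive closure up to projectives -/

section StableAdditiveClosure

variable {R : Type u} [Ring R]

/-- The closure of `V` and the projective modules under finite direct sums and direct summands. -/
inductive StableAdd (V : FGModuleCat.{u} R) : FGModuleCat.{u} R → Prop
  | self : StableAdd V V
  | projective {P : FGModuleCat.{u} R} : Module.Projective R P → StableAdd V P
  | prod {A B C : FGModuleCat.{u} R} : (C ≃ₗ[R] (A × B)) → StableAdd V A → StableAdd V B →
      StableAdd V C
  | summand {X M : FGModuleCat.{u} R} : IsDirectSummand X M → StableAdd V M → StableAdd V X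

namespace StableAdd

variable {U V W : FGModuleCat.{u} R}

theorem trans (h₁ : StableAdd U V) (h₂ : StableAdd V W) : StableAdd U W := by
  induction h₂ with
  | self => exact h₁
  | projective h => exact .projective h
  | prod e _ _ hA hB => exact .prod e hA hB
  | summand h _ hM => exact .summand h hM

theorem of_equiv (e : V ≃ₗ[R] W) : StableAdd V W := by
  obtain ⟨Y, ⟨e'⟩⟩ := isDirectSummand_self W
  exact .summand ⟨Y, ⟨e.trans e'⟩⟩ .self

theorem projective_of_projective (h : StableAdd V W) (hV : Module.Projective R V) :
    Module.Projective R W := by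
  induction h with
  | self => exact hV
  | projective h => exact h
  | prod e _ _ hA hB => exact (projective_prod_iff e).2 ⟨hA, hB⟩
  | summand h _ hM => exact h.projective hM

variable [IsArtinianRing R]

theorem iterSyzygy (h : StableAdd V W) (n : ℕ) :
    StableAdd (iterSyzygy n V) (iterSyzygy n W) := by
  induction h with
  | self => exact .self
  | projective h =>
    refine .projective (pd_le_iff_projective.1 ?_)
    exact (pd_le_zero_iff.2 h).trans zero_le
  | prod e _ _ hA hB =>
    obtain ⟨E⟩ := nonempty_iterSyzygy_prod e n
    exact .prod E hA hB
  | summand h _ hM => exact .summand (h.iterSyzygy n) hM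

/-- The Krull–Schmidt property makes taking sums and summands create no new nonprojective
indecomposables. Every comparison of `Φ` and `Ψ` along `StableAdd` rests on this. -/
theorem projective_or_isDirectSummand (h : StableAdd V W) {X : FGModuleCat.{u} R}
    (hX : IsIndecomposable X) (hXW : IsDirectSummand X W) :
    Module.Projective R X ∨ IsDirectSummand X V := by
  induction h with
  | self => exact Or.inr hXW
  | projective h => exact Or.inl (hXW.projective h)
  | prod e _ _ hA hB => exact (hX.isDirectSummand_or e hXW).elim hA hB
  | summand h _ hM => exact hM (hXW.trans h)

end StableAdd

end StableAdditiveClosure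

/-! ### The function `Φ` -/

section Phi

variable {R : Type u} [Ring R] [IsArtinianRing R]

theorem omegaSummandGroup_succ (m : ℕ) (M : FGModuleCat.{u} R) :
    omegaSummandGroup (m + 1) M = (omegaSummandGroup m M).map (omega R) :=
  Function.iterate_succ_apply' _ _ _

/-- The target is by construction the image, so only injectivity matters; and injectivity passes to
subgroups. -/
theorem bijOn_omega_iff {m : ℕ} {M : FGModuleCat.{u} R} :
    Set.BijOn (omega R) (omegaSummandGroup m M) (omegaSummandGroup (m + 1) M) ↔
      Set.InjOn (omega R) (omegaSummandGroup m M) := by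
  rw [omegaSummandGroup_succ, AddSubgroup.coe_map]
  exact ⟨Set.BijOn.injOn, Set.InjOn.bijOn_image⟩

theorem mem_omegaSummandGroup {m : ℕ} {M : FGModuleCat.{u} R} {y : StableGroup R} :
    y ∈ omegaSummandGroup m M ↔ ∃ x ∈ summandGroup M, ((omega R).toIntLinearMap ^ m) x = y := by
  induction m generalizing y with
  | zero =>
    change y ∈ summandGroup M ↔ _
    simp
  | succ m ih =>
    rw [omegaSummandGroup_succ, AddSubgroup.mem_map]
    constructor
    · rintro ⟨z, hz, rfl⟩
      obtain ⟨x, hx, rfl⟩ := ih.1 hz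
      exact ⟨x, hx, by rw [pow_succ', Module.End.mul_apply]; rfl⟩
    · rintro ⟨x, hx, rfl⟩
      exact ⟨_, ih.2 ⟨x, hx, rfl⟩, by rw [pow_succ', Module.End.mul_apply]; rfl⟩

/-- The maps `Ω : Ωᵐ⟨M⟩ → Ωᵐ⁺¹⟨M⟩` are eventually injective. -/
theorem exists_injOn_omega (M : FGModuleCat.{u} R) :
    ∃ n, ∀ m ≥ n, Set.InjOn (omega R) (omegaSummandGroup m M) := by
  have hfg : AddGroup.FG (summandGroup M) :=
    (AddGroup.fg_iff_addSubgroup_fg _).2 ((AddSubgroup.fg_iff _).2 ⟨_, rfl, finite_cls_summands M⟩)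
  have : Module.Finite ℤ (summandGroup M) := Module.Finite.iff_addGroup_fg.2 hfg
  -- The kernels of `Ωⁿ` on `⟨M⟩` form an ascending chain in a Noetherian `ℤ`-module.
  let K : ℕ →o Submodule ℤ (summandGroup M) :=
    { toFun := fun n ↦ LinearMap.ker
        (((omega R).toIntLinearMap ^ n) ∘ₗ (summandGroup M).subtype.toIntLinearMap)
      monotone' := monotone_nat_of_le_succ fun n x hx ↦ by
        have hx' : ((omega R).toIntLinearMap ^ n) x = 0 := hx
        change ((omega R).toIntLinearMap ^ (n + 1)) x = 0
        rw [pow_succ', Module.End.mul_apply, hx', map_zero] }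
  obtain ⟨n, hn⟩ := monotone_stabilizes_iff_noetherian.2
    (inferInstance : IsNoetherian ℤ (summandGroup M)) K
  refine ⟨n, fun m hm ↦ ?_⟩
  intro a ha b hb hab
  rw [← sub_eq_zero]
  -- With `a - b = Ωᵐ x`, the element `x` is killed by `Ωᵐ⁺¹`, hence already by `Ωᵐ`.
  obtain ⟨x, hx, hxy⟩ := mem_omegaSummandGroup.1 (sub_mem ha hb)
  have h1 : (⟨x, hx⟩ : summandGroup M) ∈ K (m + 1) := by
    change ((omega R).toIntLinearMap ^ (m + 1)) x = 0
    rw [pow_succ', Module.End.mul_apply, hxy]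
    change omega R (a - b) = 0
    rw [map_sub, hab, sub_self]
  rw [← hn (m + 1) (hm.trans (Nat.le_succ m)), hn m hm] at h1
  have h2 : ((omega R).toIntLinearMap ^ m) x = 0 := h1
  rw [← hxy, h2]

theorem phi_le {M : FGModuleCat.{u} R} {n : ℕ}
    (h : ∀ m ≥ n, Set.InjOn (omega R) (omegaSummandGroup m M)) : phi M ≤ n :=
  Nat.sInf_le fun m hm ↦ bijOn_omega_iff.2 (h m hm)

theorem injOn_omega_of_phi_le {M : FGModuleCat.{u} R} {m : ℕ} (hm : phi M ≤ m) :
    Set.InjOn (omega R) (omegaSummandGroup m M) := by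
  -- Nonemptiness ensures that the `sInf` defining `phi` is attained and is not the default `0`.
  have hne : {n | ∀ m ≥ n, Set.BijOn (omega R) (omegaSummandGroup m M)
      (omegaSummandGroup (m + 1) M)}.Nonempty :=
    (exists_injOn_omega M).imp fun n hn m hm ↦ bijOn_omega_iff.2 (hn m hm)
  exact (Nat.sInf_mem hne m hm).injOn

theorem iterate_map_omega_mono (m : ℕ) : Monotone (AddSubgroup.map (omega R))^[m] :=
  Monotone.iterate (fun _ _ h ↦ AddSubgroup.map_mono h) m

theorem phi_le_of_summandGroup_le {M N : FGModuleCat.{u} R}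
    (h : summandGroup M ≤ summandGroup N) : phi M ≤ phi N :=
  phi_le fun m hm ↦ (injOn_omega_of_phi_le hm).mono (iterate_map_omega_mono m h)

/-- For an indecomposable summand `X` of `M`, `Ω X` is a summand of `Ω M`. It may decompose, but its
class is the sum of those of its indecomposable summands. -/
theorem map_omega_summandGroup_le (M : FGModuleCat.{u} R) :
    (summandGroup M).map (omega R) ≤ summandGroup (syzygy M) := by
  rw [AddSubgroup.map_le_iff_le_comap, summandGroup, AddSubgroup.closure_le]
  rintro _ ⟨X, -, hXM, rfl⟩
  change omega R (cls X) ∈ summandGroup (syzygy M)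
  rw [omega_cls]
  exact summandGroup_mono (hXM.iterSyzygy 1) (cls_mem_summandGroup _)

/-- `Ωᵐ⁺¹⟨M⟩ ⊆ Ωᵐ⟨ΩM⟩`, and `Ω` is injective on the larger group once `m ≥ Φ(ΩM)`. -/
theorem phi_le_phi_syzygy (M : FGModuleCat.{u} R) : phi M ≤ phi (syzygy M) + 1 := by
  refine phi_le fun m hm ↦ ?_
  obtain ⟨m, rfl⟩ := Nat.exists_eq_add_of_le' (le_of_add_le_right hm)
  exact (injOn_omega_of_phi_le (Nat.le_of_add_le_add_right hm)).mono
    (iterate_map_omega_mono m (map_omega_summandGroup_le M))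

end Phi

/-! ### The function `Ψ` -/

section Psi

variable {R : Type u} [Ring R]

theorem pfd_le {C : Set (FGModuleCat.{u} R)} {b : ℕ∞} (h : ∀ X ∈ C, pd X ≠ ⊤ → pd X ≤ b) :
    pfd C ≤ b :=
  sSup_le fun _ ⟨hd, X, hX, hXd⟩ ↦ hXd ▸ h X hX (hXd ▸ hd)

variable [IsArtinianRing R]

theorem coe_psi (M : FGModuleCat.{u} R) :
    (psi M : ℕ∞) = phi M + pfd {X | IsDirectSummand X (iterSyzygy (phi M) M)} := by
  rw [psi, Nat.cast_add, ENat.natCast_toNat (pfd_summands_ne_top _)]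

/-- In the definition of `Ψ`, the number `Φ(M)` may be replaced by any larger one at the cost of
an inequality. -/
theorem psi_le_of_phi_le {M : FGModuleCat.{u} R} {k : ℕ} (hk : phi M ≤ k) :
    (psi M : ℕ∞) ≤ k + pfd {X | IsDirectSummand X (iterSyzygy k M)} := by
  obtain ⟨q, rfl⟩ := Nat.exists_eq_add_of_le' hk
  obtain ⟨b, hb⟩ := ENat.ne_top_iff_exists.1 (pfd_summands_ne_top (iterSyzygy (q + phi M) M))
  -- Taking `q` further syzygies lowers a finite projective dimension by at most `q`, which is
  -- exactly what `k = q + Φ(M)` adds.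
  have : pfd {X | IsDirectSummand X (iterSyzygy (phi M) M)} ≤ (b + q : ℕ) := by
    refine pfd_le fun X hX hpd ↦ ?_
    obtain ⟨d, hd⟩ := ENat.ne_top_iff_exists.1 hpd
    rw [← pd_iterSyzygy_le_iff, hb]
    refine pd_le_pfd ?_ ?_
    · change IsDirectSummand _ _
      rw [iterSyzygy_add]
      exact IsDirectSummand.iterSyzygy hX q
    · refine ne_top_of_le_ne_top (ENat.natCast_ne_top d) (pd_iterSyzygy_le_iff.2 ?_)
      rw [← hd]
      exact_mod_cast Nat.le_add_right d q
  rw [coe_psi, ← hb]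
  refine (add_le_add_right this _).trans ?_
  norm_cast
  omega

/-- Evaluating at `k = Φ(ΩM) + 1` instead of `Φ(M)` gives the very syzygy that enters `Ψ(ΩM)`. -/
theorem psi_le_psi_syzygy (M : FGModuleCat.{u} R) : psi M ≤ psi (syzygy M) + 1 := by
  have h := psi_le_of_phi_le (phi_le_phi_syzygy M)
  have h2 := coe_psi (syzygy M)
  rw [show iterSyzygy (phi (syzygy M) + 1) M = iterSyzygy (phi (syzygy M)) (syzygy M) from rfl,
    Nat.cast_add, add_right_comm, ← h2] at h
  exact_mod_cast h

theorem psi_le_psi_iterSyzygy (n : ℕ) (M : FGModuleCat.{u} R) :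
    psi M ≤ n + psi (iterSyzygy n M) := by
  induction n generalizing M with
  | zero => exact (Nat.zero_add _).ge
  | succ n ih =>
    have h1 := psi_le_psi_syzygy M
    have h2 : psi (syzygy M) ≤ n + psi (iterSyzygy (n + 1) M) := ih (syzygy M)
    omega

theorem StableAdd.summandGroup_le {V W : FGModuleCat.{u} R} (h : StableAdd V W) :
    summandGroup W ≤ summandGroup V := by
  rw [summandGroup, AddSubgroup.closure_le]
  rintro _ ⟨X, hX, hXW, rfl⟩
  rcases h.projective_or_isDirectSummand hX hXW with hP | hXV
  · rw [cls_projective hP]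
    exact zero_mem _
  · exact AddSubgroup.subset_closure ⟨X, hX, hXV, rfl⟩

theorem StableAdd.pfd_summands_le {V W : FGModuleCat.{u} R} (h : StableAdd V W) :
    pfd {X | IsDirectSummand X W} ≤ pfd {X | IsDirectSummand X V} := by
  obtain ⟨b, hb⟩ := ENat.ne_top_iff_exists.1 (pfd_summands_ne_top V)
  rw [← hb]
  refine pfd_le fun X hX hpd ↦ pd_le_of_indecomposable_summands fun Y hY hYX ↦ ?_
  rcases h.projective_or_isDirectSummand hY (hYX.trans hX) with hP | hYV
  · exact (pd_le_zero_iff.2 hP).trans zero_le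
  · obtain ⟨d, hd⟩ := ENat.ne_top_iff_exists.1 hpd
    rw [hb]
    exact pd_le_pfd hYV (ne_top_of_le_ne_top (ENat.natCast_ne_top d) (hYX.pd_le hd.ge))

/-- `Φ(W) ≤ Φ(V)`, so both functions can be compared at the common exponent `Φ(V)`. -/
theorem StableAdd.psi_le {V W : FGModuleCat.{u} R} (h : StableAdd V W) : psi W ≤ psi V := by
  have h1 := psi_le_of_phi_le (phi_le_of_summandGroup_le h.summandGroup_le)
  have h2 := (h.iterSyzygy (phi V)).pfd_summands_le
  have h3 := h1.trans (add_le_add_right h2 _)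
  rw [← coe_psi] at h3
  exact_mod_cast h3

end Psi

end StratSys

namespace StratSys

universe u

/-! ### Horseshoe lemma: syzygies of extensions -/

section Syzygies

variable {R : Type u} [Ring R] [IsArtinianRing R]

theorem iterSyzygy_succ (n : ℕ) (M : FGModuleCat.{u} R) :
    iterSyzygy (n + 1) M = syzygy (iterSyzygy n M) :=
  Function.iterate_succ_apply' _ _ _

/-- Vanishing, and not just projectivity, is needed for left-hand terms of extensions: an extension
by a projective submodule need not split. -/
theorem subsingleton_syzygy_of_projective {P : FGModuleCat.{u} R} (hP : Module.Projective R P) :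
    Subsingleton (syzygy P) := by
  have h : IsProjectiveCover (LinearMap.id : P →ₗ[R] P) :=
    ⟨hP, Function.surjective_id, fun N hN ↦ by simpa using hN⟩
  obtain ⟨E⟩ := (isProjectiveCover_projCoverMap P).nonempty_ker_equiv h (LinearEquiv.refl R P)
  have : Subsingleton (LinearMap.ker (LinearMap.id : P →ₗ[R] P)) := by
    rw [LinearMap.ker_id]; infer_instance
  exact E.toEquiv.subsingleton

/-- The horseshoe lemma for one syzygy. -/
theorem IsExtension.exists_syzygy {A B C : FGModuleCat.{u} R} (h : IsExtension A B C) :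
    ∃ K : FGModuleCat.{u} R, IsExtension (syzygy A) K (syzygy C) ∧
      StableAdd (syzygy B) K ∧ StableAdd K (syzygy B) := by
  obtain ⟨f, g, hf, hfg, hg⟩ := h
  have hA := isProjectiveCover_projCoverMap A
  have hB := isProjectiveCover_projCoverMap B
  have hC := isProjectiveCover_projCoverMap C
  have hPA := hA.projective
  have hPC := hC.projective
  obtain ⟨σ, hσ⟩ := Module.projective_lifting_property g (projCoverMap C) hg
  have hσ' : ∀ y, g (σ y) = projCoverMap C y := LinearMap.congr_fun hσ
  let q : (projCover A × projCover C) →ₗ[R] B := (f ∘ₗ projCoverMap A).coprod σ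
  have hq : ∀ x y, q (x, y) = f (projCoverMap A x) + σ y := fun x y ↦ rfl
  have hgq : ∀ w, g (q w) = projCoverMap C w.2 := fun w ↦ by
    rw [← Prod.mk.eta (p := w), hq, map_add, hfg.apply_apply_eq_zero, zero_add, hσ']
  have hqs : Function.Surjective q := by
    intro b
    obtain ⟨y, hy⟩ := hC.surjective (g b)
    obtain ⟨a, ha⟩ := (hfg (b - σ y)).1 (by rw [map_sub, hσ', hy, sub_self])
    obtain ⟨x, rfl⟩ := hA.surjective a
    exact ⟨(x, y), by rw [hq, ha, sub_add_cancel]⟩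
  have hPQ : Module.Projective R (FGModuleCat.of R (projCover A × projCover C)) :=
    inferInstanceAs (Module.Projective R (projCover A × projCover C))
  -- The cover `q` of `B` need not be minimal; Schanuel's lemma compares its kernel with `Ω B`.
  obtain ⟨E⟩ := nonempty_ker_prod_equiv (Q := FGModuleCat.of R (projCover A × projCover C))
    hB.projective hPQ hB.surjective hqs
  let K := FGModuleCat.of R (LinearMap.ker q)
  have s₁ : StableAdd (syzygy B) K := by
    refine .summand ⟨projCover B, ⟨LinearEquiv.refl R _⟩⟩
      (.prod (C := FGModuleCat.of R (K × projCover B)) E.symm .self (.projective hPQ))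
  have s₂ : StableAdd K (syzygy B) := by
    refine .summand ⟨FGModuleCat.of R (projCover A × projCover C), ⟨LinearEquiv.refl R _⟩⟩
      (.prod (A := K) (B := projCover B)
        (C := FGModuleCat.of R (syzygy B × (projCover A × projCover C))) E .self
        (.projective hB.projective))
  refine ⟨K, ⟨LinearMap.codRestrict (LinearMap.ker q)
      (LinearMap.inl R _ _ ∘ₗ Submodule.subtype _) ?_,
    LinearMap.codRestrict (LinearMap.ker (projCoverMap C))
      (LinearMap.snd R _ _ ∘ₗ Submodule.subtype _) ?_, ?_, ?_, ?_⟩, s₁, s₂⟩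
  · rintro ⟨x, hx⟩
    change q (x, 0) = 0
    have hx' : projCoverMap A x = 0 := hx
    rw [hq, hx', map_zero, map_zero, add_zero]
  · rintro ⟨w, hw⟩
    change projCoverMap C w.2 = 0
    have hw' : q w = 0 := hw
    rw [← hgq, hw', map_zero]
  · intro x y hxy
    exact Subtype.ext (congrArg (fun w ↦ w.1.1) hxy)
  · rintro ⟨⟨x, y⟩, hw⟩
    have hw' : f (projCoverMap A x) + σ y = 0 := hw
    constructor
    · intro hy
      have hy' : y = 0 := congrArg Subtype.val hy
      subst hy'
      rw [map_zero, add_zero] at hw'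
      exact ⟨⟨x, hf (hw'.trans (map_zero f).symm)⟩, rfl⟩
    · rintro ⟨z, hz⟩
      exact Subtype.ext (congrArg (fun w ↦ w.1.2) hz).symm
  · rintro ⟨y, hy⟩
    have hy' : projCoverMap C y = 0 := hy
    obtain ⟨a, ha⟩ := (hfg (σ y)).1 (by rw [hσ', hy'])
    obtain ⟨x, rfl⟩ := hA.surjective a
    refine ⟨⟨(-x, y), ?_⟩, rfl⟩
    change q (-x, y) = 0
    rw [hq, map_neg, map_neg, ha, neg_add_cancel]

theorem IsExtension.exists_iterSyzygy {A B C : FGModuleCat.{u} R} (h : IsExtension A B C)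
    (n : ℕ) : ∃ K : FGModuleCat.{u} R, IsExtension (iterSyzygy n A) K (iterSyzygy n C) ∧
      StableAdd (iterSyzygy n B) K ∧ StableAdd K (iterSyzygy n B) := by
  induction n with
  | zero => exact ⟨B, h, .self, .self⟩
  | succ n ih =>
    obtain ⟨K, hK, h₁, h₂⟩ := ih
    obtain ⟨K', hK', h₁', h₂'⟩ := hK.exists_syzygy
    simp only [iterSyzygy_succ]
    exact ⟨K', hK', (h₁.iterSyzygy 1).trans h₁', h₂'.trans (h₂.iterSyzygy 1)⟩

/-- If `pd C ≤ n`, then the `n`-th syzygies of `A` and of an extension of `C` by `A` agree up to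
projective summands. -/
theorem IsExtension.stableAdd_of_pd_right_le {A B C : FGModuleCat.{u} R} (h : IsExtension A B C)
    {n : ℕ} (hC : pd C ≤ n) : StableAdd (iterSyzygy n A) (iterSyzygy n B) ∧
      StableAdd (iterSyzygy n B) (iterSyzygy n A) := by
  obtain ⟨K, hK, h₁, h₂⟩ := h.exists_iterSyzygy n
  have hP := pd_le_iff_projective.1 hC
  obtain ⟨e⟩ := hK.split_of_projective hP
  exact ⟨(StableAdd.prod e .self (.projective hP)).trans h₂,
    h₁.trans (.summand (isDirectSummand_left e) .self)⟩

/-- If `pd A ≤ n`, then the `(n + 1)`-st syzygies of `C` and of an extension of `C` by `A` agree up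
to projective summands. -/
theorem IsExtension.stableAdd_of_pd_left_le {A B C : FGModuleCat.{u} R} (h : IsExtension A B C)
    {n : ℕ} (hA : pd A ≤ n) : StableAdd (iterSyzygy (n + 1) C) (iterSyzygy (n + 1) B) ∧
      StableAdd (iterSyzygy (n + 1) B) (iterSyzygy (n + 1) C) := by
  obtain ⟨K, ⟨f, g, -, hfg, hg⟩, h₁, h₂⟩ := h.exists_iterSyzygy (n + 1)
  have : Subsingleton (iterSyzygy (n + 1) A) := by
    rw [iterSyzygy_succ]
    exact subsingleton_syzygy_of_projective (pd_le_iff_projective.1 hA)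
  have hinj : Function.Injective g := by
    rw [← LinearMap.ker_eq_bot, LinearMap.ker_eq_bot']
    intro y hy
    obtain ⟨x, rfl⟩ := (hfg y).1 hy
    rw [Subsingleton.elim x 0, map_zero]
  let e := LinearEquiv.ofBijective g ⟨hinj, hg⟩
  exact ⟨(StableAdd.of_equiv e.symm).trans h₂, h₁.trans (StableAdd.of_equiv e)⟩

theorem StableAdd.pd_le {V W : FGModuleCat.{u} R} (h : StableAdd V W) {n : ℕ} (hV : pd V ≤ n) :
    pd W ≤ n := by
  rw [pd_le_iff_projective] at hV ⊢
  exact (h.iterSyzygy n).projective_of_projective hV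

end Syzygies

/-! ### Induction along filtrations -/

section Filtered

variable {R : Type u} [Ring R]

theorem isExtension_of_subsingleton {A B C : FGModuleCat.{u} R} (hA : Subsingleton A)
    (hB : Subsingleton B) (hC : Subsingleton C) : IsExtension A B C :=
  ⟨0, 0, fun _ _ _ ↦ Subsingleton.elim _ _,
    fun _ ↦ ⟨fun _ ↦ ⟨0, Subsingleton.elim _ _⟩, fun _ ↦ Subsingleton.elim _ _⟩,
    fun _ ↦ ⟨0, Subsingleton.elim _ _⟩⟩

theorem subsingleton_ext_of_subsingleton {X M : FGModuleCat.{u} R} (hM : Subsingleton M) :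
    Subsingleton (Abelian.Ext.{u} X.obj M.obj 1) := by
  have h0 : 𝟙 M.obj = 0 := by
    ext x
    exact Subsingleton.elim (α := M) _ _
  refine subsingleton_of_forall_eq 0 fun x ↦ ?_
  rw [← Abelian.Ext.comp_mk₀_id x, h0, Abelian.Ext.mk₀_zero, Abelian.Ext.comp_zero]

theorem IsExtension.prod_right {T E Q : FGModuleCat.{u} R} (h : IsExtension T E Q)
    (X : FGModuleCat.{u} R) :
    IsExtension (FGModuleCat.of R (T × X)) (FGModuleCat.of R (E × X)) Q := by
  obtain ⟨f, g, hf, hfg, hg⟩ := h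
  refine ⟨f.prodMap LinearMap.id, g ∘ₗ LinearMap.fst R E X,
    Function.Injective.prodMap hf Function.injective_id, ?_,
    hg.comp (LinearMap.fst_surjective (R := R) (M := E) (M₂ := X))⟩
  rintro ⟨y, z⟩
  constructor
  · intro hy
    obtain ⟨x, rfl⟩ := (hfg y).1 hy
    exact ⟨(x, z), rfl⟩
  · rintro ⟨⟨x, z'⟩, hx⟩
    have hx' : f x = y := congrArg Prod.fst hx
    exact (hfg y).2 ⟨x, hx'⟩

variable [IsNoetherianRing R]

/-- Induction along the chain of submodules of a module in `F(C)`. -/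
@[elab_as_elim]
theorem filtered_induction {C : Set (FGModuleCat.{u} R)} {motive : FGModuleCat.{u} R → Prop}
    (zero : ∀ M : FGModuleCat.{u} R, Subsingleton M → motive M)
    (extension : ∀ N M X, X ∈ C → IsExtension N M X → motive N → motive M)
    {M : FGModuleCat.{u} R} (hM : M ∈ filtered C) : motive M := by
  obtain ⟨m, F, h0, hm, hF⟩ := hM
  -- Quantifying over all copies `N` of `F i` is needed because `motive` is not assumed invariant
  -- under isomorphism.
  have key : ∀ i ≤ m, ∀ N : FGModuleCat.{u} R, (F i ≃ₗ[R] N) → motive N := by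
    intro i
    induction i with
    | zero =>
      intro _ N e
      refine zero N ?_
      have : Subsingleton (F 0) := by rw [h0]; infer_instance
      exact e.symm.toEquiv.subsingleton
    | succ i ih =>
      intro hi N e
      obtain ⟨hle, X, hX, ⟨e'⟩⟩ := hF i hi
      have hext : IsExtension (FGModuleCat.of R (F i)) (FGModuleCat.of R (F (i + 1))) X := by
        refine ⟨Submodule.inclusion hle,
          e'.toLinearMap ∘ₗ ((F i).submoduleOf (F (i + 1))).mkQ,
          Submodule.inclusion_injective hle, ?_,
          e'.surjective.comp (Submodule.mkQ_surjective _)⟩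
        intro y
        have : (e'.toLinearMap ∘ₗ ((F i).submoduleOf (F (i + 1))).mkQ) y = 0 ↔ y.1 ∈ F i := by
          rw [LinearMap.comp_apply, LinearEquiv.coe_coe, e'.map_eq_zero_iff]
          exact Submodule.Quotient.mk_eq_zero _
        exact this.trans ⟨fun hy ↦ ⟨⟨y.1, hy⟩, rfl⟩, fun ⟨x, hx⟩ ↦ hx ▸ x.2⟩
      exact extension _ N X hX (hext.equiv_middle e)
        (ih (Nat.le_of_succ_le hi) (FGModuleCat.of R (F i)) (LinearEquiv.refl R _))
  exact key m le_rfl M ((LinearEquiv.ofEq _ _ hm).trans Submodule.topEquiv)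

end Filtered

/-! ### Rearranging filtrations for a stratifying system -/

section StratifyingSystem

variable {R : Type u} [Ring R] [IsArtinianRing R]

/-- For a stratifying system `θ`, the filtration of a filtered module can be rearranged, with the
`θ(j)`, `j > i₀`, at the bottom and the `θ(j)`, `j < i₀`, at the top: there is a submodule `A` with
`pd A ≤ s` such that `M / A` is an extension of a module `Q` with `pd Q ≤ s` by a module `T` that is
zero or generates the same additive closure as `θ(i₀)`, up to projective modules. -/
theorem IsStratifyingSystem.exists_rearrangement {t : ℕ} {θ : Fin t → FGModuleCat.{u} R}
    (hθ : IsStratifyingSystem θ) {i₀ : Fin t} {s : ℕ} (hs : ∀ j ≠ i₀, pd (θ j) ≤ s)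
    {M : FGModuleCat.{u} R} (hM : M ∈ filtered (Set.range θ)) :
    ∃ A E T Q : FGModuleCat.{u} R, IsExtension A M E ∧ IsExtension T E Q ∧ pd A ≤ s ∧ pd Q ≤ s ∧
      StableAdd (θ i₀) T ∧ (Subsingleton T ∨ StableAdd T (θ i₀)) := by
  -- The induction also carries `Ext¹(θ(j), E) = 0` for `j ≥ i₀`, which makes a new top factor
  -- `θ(j)` split off.
  suffices ∃ A E T Q : FGModuleCat.{u} R, IsExtension A M E ∧ IsExtension T E Q ∧ pd A ≤ s ∧
      pd Q ≤ s ∧ StableAdd (θ i₀) T ∧ (Subsingleton T ∨ StableAdd T (θ i₀)) ∧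
      ∀ j, i₀ ≤ j → Subsingleton (Abelian.Ext.{u} (θ j).obj E.obj 1) by
    obtain ⟨A, E, T, Q, h₁, h₂, hA, hQ, hT, hT', -⟩ := this
    exact ⟨A, E, T, Q, h₁, h₂, hA, hQ, hT, hT'⟩
  refine filtered_induction (fun M hM ↦ ?_) (fun N M X hX hNM ih ↦ ?_) hM
  · have hP : Module.Projective R M := inferInstance
    have hpd : pd M ≤ s := (pd_le_zero_iff.2 hP).trans zero_le
    exact ⟨M, M, M, M, isExtension_of_subsingleton hM hM hM, isExtension_of_subsingleton hM hM hM,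
      hpd, hpd, .projective hP, Or.inl hM, fun _ _ ↦ subsingleton_ext_of_subsingleton hM⟩
  · obtain ⟨j, rfl⟩ := hX
    obtain ⟨A, E, T, Q, h₁, h₂, hA, hQ, hT, hT', hE⟩ := ih
    obtain ⟨E', hE'₁, hE'₂⟩ := h₁.assoc hNM
    rcases lt_trichotomy j i₀ with hj | rfl | hj
    -- Smaller index: the new factor stays on top and enlarges `Q`.
    · obtain ⟨Q', hQ'₁, hQ'₂⟩ := h₂.assoc hE'₂
      exact ⟨A, E', T, Q', hE'₁, hQ'₁, hA, hQ'₂.pd_le hQ (hs j hj.ne), hT, hT', fun j' hj' ↦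
        hE'₂.subsingleton_ext (hE j' hj') (hθ.ext_eq_zero j j' (hj.le.trans hj'))⟩
    -- Index `i₀`: the new factor splits off `E'` and joins `T`.
    · obtain ⟨e⟩ := hE'₂.split_of_ext (hE j le_rfl)
      refine ⟨A, E', FGModuleCat.of R (T × θ j), Q, hE'₁,
        (h₂.prod_right (θ j)).equiv_middle e.symm, hA, hQ,
        .prod (LinearEquiv.refl R _) hT .self,
        Or.inr (.summand (isDirectSummand_right (LinearEquiv.refl R _)) .self), fun j' hj' ↦
        hE'₂.subsingleton_ext (hE j' hj') (hθ.ext_eq_zero j j' hj')⟩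
    -- Larger index: the new factor splits off `E'`, and its preimage in `M` replaces `A`, leaving
    -- `E` unchanged.
    · obtain ⟨e⟩ := hE'₂.split_of_ext (hE j hj.le)
      obtain ⟨A', hA'₁, hA'₂⟩ := hE'₁.exists_of_prod e
      exact ⟨A', E, T, Q, hA'₂, h₂, hA'₁.pd_le hA (hs j hj.ne'), hQ, hT, hT', hE⟩

/-- A filtered module either has projective dimension at most `s`, or its syzygy `Ωˢ⁺¹` generates
the same additive closure as that of `θ(i₀)`, up to projective modules. -/
theorem IsStratifyingSystem.pd_le_or_stableAdd {t : ℕ} {θ : Fin t → FGModuleCat.{u} R}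
    (hθ : IsStratifyingSystem θ) {i₀ : Fin t} {s : ℕ} (hs : ∀ j ≠ i₀, pd (θ j) ≤ s)
    {M : FGModuleCat.{u} R} (hM : M ∈ filtered (Set.range θ)) :
    StableAdd (iterSyzygy (s + 1) (θ i₀)) (iterSyzygy (s + 1) M) ∧
      (pd M ≤ s ∨ StableAdd (iterSyzygy (s + 1) M) (iterSyzygy (s + 1) (θ i₀))) := by
  obtain ⟨A, E, T, Q, h₁, h₂, hA, hQ, hT, hT'⟩ := hθ.exists_rearrangement hs hM
  have hM₁ := h₁.stableAdd_of_pd_left_le hA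
  -- Exponent `s` would do for `Q`; `s + 1` matches the one needed to remove `A`.
  have hE₁ := h₂.stableAdd_of_pd_right_le (n := s + 1) (hQ.trans (by simp))
  refine ⟨((hT.iterSyzygy _).trans hE₁.1).trans hM₁.1, ?_⟩
  rcases hT' with hT' | hT'
  · have hP : Module.Projective R T := inferInstance
    exact Or.inl (h₁.pd_le hA (h₂.pd_le ((pd_le_zero_iff.2 hP).trans zero_le) hQ))
  · exact Or.inr ((hM₁.2.trans hE₁.2).trans (hT'.iterSyzygy _))

end StratifyingSystem

end StratSys

open StratSys in
theorem theorem4p6 {k : Type*} [Field k] [IsAlgClosed k] {R : Type*} [Ring R] [Algebra k R]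
    [Module.Finite k R] {t : ℕ} (θ : Fin t → FGModuleCat R) (hθ : IsStratifyingSystem θ)
    (i₀ : Fin t) (hi₀ : {i | pd (θ i) = ⊤} = {i₀})
    (s : ℕ) (hs : (s : ℕ∞) = ⨆ j ∈ {j : Fin t | j ≠ i₀}, pd (θ j)) :
    haveI : IsArtinianRing R := IsArtinianRing.of_finite k R
    pfd (filtered (Set.range θ)) ≤ s ∧
      psiDim (filtered (Set.range θ)) ≤ 1 + s + psi (iterSyzygy (s + 1) (θ i₀)) := by
  have : IsArtinianRing R := IsArtinianRing.of_finite k R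
  have hs' : ∀ j ≠ i₀, pd (θ j) ≤ s := fun j hj ↦
    hs ▸ le_iSup₂ (f := fun (j : Fin t) (_ : j ∈ {j : Fin t | j ≠ i₀}) ↦ pd (θ j)) j hj
  have htop : pd (θ i₀) = ⊤ := by
    have : i₀ ∈ {i | pd (θ i) = ⊤} := hi₀ ▸ Set.mem_singleton i₀
    exact this
  refine ⟨pfd_le fun M hM hpd ↦ ?_, iSup₂_le fun M hM ↦ ?_⟩
  -- In the other alternative, finite `pd M` would bound `pd Ωˢ⁺¹ θ(i₀)` and hence `pd θ(i₀) = ∞`.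
  · refine (hθ.pd_le_or_stableAdd hs' hM).2.resolve_right fun h ↦ ?_
    obtain ⟨d, hd⟩ := ENat.ne_top_iff_exists.1 hpd
    have h1 : pd (iterSyzygy (s + 1) M) ≤ d :=
      pd_iterSyzygy_le_iff.2 (hd ▸ by exact_mod_cast Nat.le_add_right d (s + 1))
    have h2 := pd_iterSyzygy_le_iff.1 (h.pd_le h1)
    rw [htop, top_le_iff] at h2
    exact ENat.natCast_ne_top _ h2
  · have h1 := psi_le_psi_iterSyzygy (s + 1) M
    have h2 := (hθ.pd_le_or_stableAdd hs' hM).1.psi_le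
    have h3 : psi M ≤ 1 + s + psi (iterSyzygy (s + 1) (θ i₀)) := by omega
    exact_mod_cast h3
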